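/- All graphs are finite and simple. For a graph $G$ let $k_t(G)$ denote the number of $t$-cliques of $G$, i.e. of $t$-element sets of pairwise adjacent vertices. $G$ is \emph{traceable} if it has a Hamiltonian path, \emph{Hamiltonian} if it has a Hamiltonian cycle (the one-vertex graph being counted as Hamiltonian by convention), and \emph{Hamiltonian-connected} if every two distinct vertices are joined by a Hamiltonian path. $G$ is \emph{$k$-path Hamiltonian} if every path of length at most $k$ in $G$ is contained in a Hamiltonian cycle of $G$, and \emph{$k$-Hamiltonian} if for every $0\le \ell\le k$ the removal of any $\ell$ vertices of $G$ results in a Hamiltonian graph. The colex order on finite subsets of $\mathbb N$ is defined by $A<_C B$ if and only if $A\ne B$ and $\max(A\bigtriangleup B)\in B$. The \emph{colex graph} $\mathcal C(m)$ is the graph whose edges are the first $m$ two-element subsets of $\mathbb N$ in colex order and whose vertex set is the union of these edges. Let $G$ be a graph on $n\ge 1$ vertices and let $t\ge 2$. \begin{enumerate} \item If $G$ is not traceable, then $k_t(G)\le k_t(K_{n-1})$. If $G$ is a $K_{n-1}$ plus an isolated vertex, then equality holds, and $G$ is not traceable if $n\ge 2$. \item If $G$ is not Hamiltonian, then $k_t(G)\le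 k_t\big(\mathcal C(\binom{n-1}{2}+1)\big)$. If $G\cong \mathcal C(\binom{n-1}{2}+1)$, then $G$ is not Hamiltonian and equality holds. For $n\ge 2$, $\mathcal C(\binom{n-1}{2}+1)$ has $n$ vertices and is a $K_{n-1}$ plus a vertex of degree $1$. \item Let $n\ge 4$. If $G$ is not Hamiltonian-connected, then $k_t(G)\le k_t\big(\mathcal C(\binom{n-1}{2}+2)\big)$. If $G\cong \mathcal C(\binom{n-1}{2}+2)$, then $G$ is not Hamiltonian-connected and equality holds. Moreover $\mathcal C(\binom{n-1}{2}+2)$ has $n$ vertices and is a $K_{n-1}$ plus a vertex of degree $2$. \item Let $0\le k\le n-3$. If $G$ is not $k$-path Hamiltonian, then $k_t(G)\le k_t\big(\mathcal C(\binom{n-1}{2}+k+1)\big)$. If $G\cong \mathcal C(\binom{n-1}{2}+k+1)$, then $G$ is not $k$-path Hamiltonian and equality holds. \item Let $0\le k\le n-3$. If $G$ is not $k$-Hamiltonian, then $k_t(G)\le k_t\big(\mathcal C(\binom{n-1}{2}+k+1)\big)$. If $G\cong \mathcal C(\binom{n-1}{2}+k+1)$, then $G$ is not $k$-Hamiltonian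 and equality holds. \end{enumerate} For $0\le k\le n-3$, the graph $\mathcal C(\binom{n-1}{2}+k+1)$ in parts 4 and 5 has $n$ vertices and is a $K_{n-1}$ plus a vertex of degree $k+1$. -/

import Mathlib

namespace SimpleGraph

/-- `G` contains a Hamiltonian path. -/
def IsTraceable {V : Type*} [DecidableEq V] (G : SimpleGraph V) : Prop :=
  ∃ (u v : V) (p : G.Walk u v), p.IsHamiltonian

/-- Every pair of distinct vertices of `G` is joined by a Hamiltonian path. -/
def IsHamiltonianConnected {V : Type*} [DecidableEq V] (G : SimpleGraph V) : Prop :=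
  ∀ u v : V, u ≠ v → ∃ p : G.Walk u v, p.IsHamiltonian

/-- Every path of `G` of length at most `k` is contained in a Hamiltonian cycle of `G`. -/
def IsPathHamiltonian {V : Type*} [DecidableEq V] (G : SimpleGraph V) (k : ℕ) : Prop :=
  ∀ (u v : V) (p : G.Walk u v), p.IsPath → p.length ≤ k →
    ∃ (a : V) (c : G.Walk a a), c.IsHamiltonianCycle ∧ p.toSubgraph ≤ c.toSubgraph

/-- The removal of any set of at most `k` vertices of `G` results in a Hamiltonian graph. -/
def IsKHamiltonian {V : Type*} [Fintype V] [DecidableEq V] (G : SimpleGraph V) (k : ℕ) : Prop :=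
  ∀ s : Finset V, s.card ≤ k → (G.induce (↑(sᶜ) : Set V)).IsHamiltonian

/-- The number of `t`-cliques of `G`. -/
noncomputable def numCliques {V : Type*} (G : SimpleGraph V) (t : ℕ) : ℕ :=
  (G.cliqueSet t).ncard

/-- `G` is a complete graph together with one more vertex, of degree `d`. -/
def IsCompletePlusVertex {V : Type*} (G : SimpleGraph V) (d : ℕ) : Prop :=
  ∃ v : V, (G.neighborSet v).encard = d ∧ ∀ x y : V, x ≠ v → y ≠ v → x ≠ y → G.Adj x y

/-- The first `m` two-element subsets of `ℕ` in the colexicographic order: those which have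
fewer than `m` predecessors. -/
def colexPairs (m : ℕ) : Set (Finset ℕ) :=
  {P | P.card = 2 ∧
    {Q : Finset ℕ | Q.card = 2 ∧ toColex Q < toColex P}.encard < m}

/-- The graph on all of `ℕ` whose edges are the first `m` pairs in the colexicographic order. -/
def colexGraphNat (m : ℕ) : SimpleGraph ℕ where
  Adj i j := i ≠ j ∧ {i, j} ∈ colexPairs m
  symm := ⟨fun i j h => ⟨h.1.symm, by rw [Finset.pair_comm]; exact h.2⟩⟩
  loopless := ⟨fun _ h => h.1 rfl⟩

/-- The colex graph on `m` edges; its vertices are the natural numbers that lie in some edge. -/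
def colexGraph (m : ℕ) : SimpleGraph (colexGraphNat m).support :=
  (colexGraphNat m).induce (colexGraphNat m).support

end SimpleGraph

/-! Each upper bound reduces to an edge count. Let j be 0 for traceability, 1 for Hamiltonicity, 2
for Hamiltonian-connectedness, and k + 1 for the two properties with parameter k. A graph with more
than C(n-1, 2) + j edges has at most n - 2 - j non-edges, and so few non-edges force the property. A
graph lacking it thus has at most C(n-1, 2) + j edges, and by Kruskal–Katona
(`numCliques_le_colexGraphNat`) it has no more t-cliques than the colex graph with that many edges.

The sparse-complement side rests on `exists_cycle_of_degreeSumOn_le`: with at most #s - 3 non-edges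
inside `s`, a cycle through `s` is built by inserting vertices one at a time. An auxiliary vertex
turns this into paths whose ends avoid a given set (`exists_isChain_avoiding`), from which all five
properties follow. Non-edges are counted through `degreeSumOn`, which counts each twice.

For sharpness, the extremal graph is a complete graph plus a vertex `w` of degree j. A Hamiltonian
cycle containing a path through exactly the neighbours of `w` closes up at `w` too early
(`Walk.IsHamiltonianCycle.adj_of_path_through_neighborSet`). -/

namespace SimpleGraph

open Finset

/-! ### Cycles and paths in graphs with sparse complement -/

section SparseComplement

variable {W : Type*} [DecidableEq W]

open Classical in
/-- The sum over `x ∈ s` of the number of neighbours of `x` in `s`. -/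
noncomputable def degreeSumOn (H : SimpleGraph W) (s : Finset W) : ℕ :=
  ∑ x ∈ s, #{y ∈ s | H.Adj x y}

omit [DecidableEq W] in
theorem degreeSumOn_eq (H : SimpleGraph W) [DecidableRel H.Adj] (s : Finset W) :
    H.degreeSumOn s = ∑ x ∈ s, #{y ∈ s | H.Adj x y} := by
  rw [degreeSumOn]
  congr!

open Classical in
theorem degreeSumOn_insert (H : SimpleGraph W) {s : Finset W} {v : W} (hv : v ∉ s) :
    H.degreeSumOn (insert v s) = H.degreeSumOn s + 2 * #{y ∈ s | H.Adj v y} := by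
  have h1 : ∀ x ∈ s, #{y ∈ insert v s | H.Adj x y}
      = #{y ∈ s | H.Adj x y} + if H.Adj v x then 1 else 0 := by
    intro x _
    rw [filter_insert, H.adj_comm x v]
    split_ifs with h
    · rw [card_insert_of_notMem (by simp [hv])]
    · rfl
  rw [degreeSumOn, sum_insert hv, sum_congr rfl h1, sum_add_distrib, ← card_filter,
    filter_insert, if_neg (H.irrefl), degreeSumOn]
  ring

open Classical in
theorem degreeSumOn_eq_erase (H : SimpleGraph W) {s : Finset W} {v : W} (hv : v ∈ s) :
    H.degreeSumOn s = H.degreeSumOn (s.erase v) + 2 * #{y ∈ s | H.Adj v y} := by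
  conv_lhs => rw [← insert_erase hv, degreeSumOn_insert H (notMem_erase v s)]
  congr 3
  ext y
  simp only [mem_filter, mem_erase, and_congr_left_iff, and_iff_right_iff_imp]
  exact fun h _ => h.ne'

open Classical in
/-- In a sparse graph some vertex has small degree, and positive degree unless the graph has no
edges. -/
theorem exists_small_degree (H : SimpleGraph W) {s : Finset W} (hs : 4 ≤ #s)
    (h : H.degreeSumOn s + 6 ≤ 2 * #s) :
    ∃ v ∈ s, 2 * #{y ∈ s | H.Adj v y} + 2 ≤ #s ∧
      H.degreeSumOn (s.erase v) + 6 ≤ 2 * #(s.erase v) := by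
  by_cases h0 : ∃ x ∈ s, ∃ y ∈ s, H.Adj x y
  · obtain ⟨x, hx, y, hy, hxy⟩ := h0
    have hd : ∀ a ∈ s, ∀ b ∈ s, H.Adj a b → 1 ≤ #{y ∈ s | H.Adj a y} := fun a _ b hb hab =>
      card_pos.2 ⟨b, by simp [hb, hab]⟩
    have e1 := H.degreeSumOn_eq_erase hx
    have e2 := H.degreeSumOn_eq_erase (mem_erase.2 ⟨hxy.ne', hy⟩)
    have e3 : #{z ∈ s | H.Adj y z} = #{z ∈ s.erase x | H.Adj y z} + 1 := by
      rw [← card_erase_add_one (a := x) (by simp [hx, hxy.symm]), filter_erase]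
    have e4 := H.degreeSumOn_eq_erase hy
    have p1 := hd x hx y hy hxy
    have p2 := hd y hy x hx hxy.symm
    -- At least d(x) + d(y) - 1 edges meet `x` or `y`, and there are at most #s - 3 edges, so the
    -- smaller degree is at most (#s - 2) / 2. Being positive, it also pays for the lost vertex in
    -- the second bound.
    rcases le_total #{z ∈ s | H.Adj x z} #{z ∈ s | H.Adj y z} with hle | hle
    · exact ⟨x, hx, by omega, by rw [card_erase_of_mem hx]; omega⟩
    · exact ⟨y, hy, by omega, by rw [card_erase_of_mem hy]; omega⟩
  · push Not at h0
    obtain ⟨v, hv⟩ : s.Nonempty := card_pos.1 (by omega)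
    have hz : ∀ x ∈ s, #{y ∈ s | H.Adj x y} = 0 := fun x hx => by
      simpa [filter_eq_empty_iff] using h0 x hx
    have h1 : H.degreeSumOn s = 0 := sum_eq_zero hz
    have := H.degreeSumOn_eq_erase hv
    exact ⟨v, hv, by rw [hz v hv]; omega, by rw [card_erase_of_mem hv]; omega⟩

/-- A cyclic list most of whose entries satisfy `p` has two cyclically consecutive entries that
satisfy `p`. -/
theorem _root_.List.exists_consecutive_of_length (l : List W) (hl : l.Nodup) (p : W → Prop)
    [DecidablePred p] (h : 2 * #{x ∈ l.toFinset | ¬ p x} < l.length) :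
    ∃ i, ∃ h1 : i < l.length, ∃ h2 : (i + 1) % l.length < l.length,
      p l[i] ∧ p l[(i + 1) % l.length] := by
  have hN : 0 < l.length := by omega
  by_contra! hc
  -- If every cyclically consecutive pair contains a bad entry, summing around the cycle counts each
  -- bad entry twice, so at least half of the entries are bad.
  let c : W → ℕ := fun x => if p x then 0 else 1
  let g : ℕ → ℕ := fun i => c (l[i % l.length]'(Nat.mod_lt _ hN))
  have h1 : ∀ i ∈ range l.length, 1 ≤ g i + g (i + 1) := by
    intro i hi
    have hi' := mem_range.1 hi
    have := hc i hi' (Nat.mod_lt _ hN)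
    simp only [g, c, Nat.mod_eq_of_lt hi']
    split_ifs <;> simp_all
  have h2 := sum_le_sum h1
  have h3 : g l.length = g 0 := by simp only [g, Nat.mod_self, Nat.zero_mod]
  have h4 := sum_range_succ g l.length
  rw [sum_range_succ', h3] at h4
  have h5 : ∑ i ∈ range l.length, g i = #{x ∈ l.toFinset | ¬ p x} := by
    rw [card_filter, List.sum_toFinset _ hl, ← List.ofFn_getElem (xs := l.map _),
      List.sum_ofFn, ← Fin.sum_univ_eq_sum_range]
    refine Fintype.sum_equiv (finCongr (by simp)) _ _ fun i => ?_
    simp [g, c, Nat.mod_eq_of_lt i.2, ite_not]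
  rw [sum_add_distrib, h5] at h2
  simp only [sum_const, card_range, smul_eq_mul, mul_one] at h2
  omega

/-- Fewer than half of the entries are non-neighbours of `v`, so two consecutive ones are
neighbours. Rotating them to the last and first positions lets `v` be put between them. -/
theorem exists_chain_insert (G : SimpleGraph W) (v : W) (l : List W) (hl : l.Nodup)
    (hc : Cycle.Chain G.Adj l) [DecidablePred (G.Adj v)]
    (h : 2 * #{x ∈ l.toFinset | ¬ G.Adj v x} < l.length) :
    ∃ l' : List W, l'.Perm l ∧ Cycle.Chain G.Adj (v :: l' : List W) := by
  obtain ⟨i, h1, h2, hp, hq⟩ := l.exists_consecutive_of_length hl (G.Adj v) h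
  have hrot : Cycle.Chain G.Adj (l.rotate (i + 1) : List W) := by
    rwa [show ((l.rotate (i + 1) : List W) : Cycle W) = l from
      Quotient.sound (List.IsRotated.symm ⟨i + 1, rfl⟩)]
  refine ⟨l.rotate (i + 1), l.rotate_perm _, ?_⟩
  have hne : l.rotate (i + 1) ≠ [] := by
    rw [ne_eq, List.rotate_eq_nil_iff]; rintro rfl; simp at h1
  have hhead : (l.rotate (i + 1)).head hne = l[(i + 1) % l.length] := by
    rw [List.head_eq_getElem, List.getElem_rotate]; simp
  have hlast : (l.rotate (i + 1)).getLast hne = l[i] := by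
    rw [List.getLast_eq_getElem, List.getElem_rotate]
    congr 1
    rw [List.length_rotate, show l.length - 1 + (i + 1) = i + l.length by omega,
      Nat.add_mod_right, Nat.mod_eq_of_lt h1]
  generalize l.rotate (i + 1) = l' at *
  rw [← hhead] at hq
  rw [← hlast] at hp
  obtain ⟨a, m, rfl⟩ := List.exists_cons_of_ne_nil hne
  rw [Cycle.chain_coe_cons] at hrot ⊢
  have hch : List.IsChain G.Adj (a :: m) := by
    have : a :: (m ++ [a]) = (a :: m) ++ [a] := rfl
    rw [this] at hrot
    exact hrot.left_of_append
  rw [List.isChain_cons]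
  refine ⟨by simpa using hq, ?_⟩
  rw [List.isChain_append]
  refine ⟨hch, by simp, ?_⟩
  simp only [List.getLast?_eq_some_getLast hne, Option.mem_def, Option.some.injEq,
    List.head?_cons, forall_eq']
  exact hp.symm

/-- A graph whose complement has at most `#s - 3` edges inside `s` has a cycle through exactly the
vertices of `s`. -/
theorem exists_cycle_of_degreeSumOn_le (H : SimpleGraph W) (s : Finset W) (hs : 3 ≤ #s)
    (h : H.degreeSumOn s + 6 ≤ 2 * #s) :
    ∃ l : List W, l.Nodup ∧ l.toFinset = s ∧ Cycle.Chain Hᶜ.Adj l := by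
  classical
  induction hk : #s using Nat.strong_induction_on generalizing s with
  | _ k ih =>
  rcases hs.eq_or_lt with h3 | h4
  · obtain ⟨x, y, z, hxy, hxz, hyz, rfl⟩ := card_eq_three.1 h3.symm
    have h0 : H.degreeSumOn {x, y, z} = 0 := by omega
    have hn : ∀ a ∈ ({x, y, z} : Finset W), ∀ b ∈ ({x, y, z} : Finset W), ¬ H.Adj a b := by
      intro a ha b hb hab
      have := (sum_eq_zero_iff.1 h0) a ha
      rw [card_eq_zero, filter_eq_empty_iff] at this
      exact this hb hab
    refine ⟨[x, y, z], by simp [hxy, hxz, hyz], by simp, ?_⟩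
    rw [Cycle.chain_coe_cons]
    simp [compl_adj, hxy, hyz, hxz.symm, hn]
  -- `v` has at most (#s - 2) / 2 non-neighbours, fewer than half of the #s - 1 vertices on the
  -- cycle through the rest, so it can be reinserted.
  · obtain ⟨v, hv, hd, he⟩ := H.exists_small_degree h4 h
    have hcard := card_erase_of_mem hv
    obtain ⟨l, hl, hls, hc⟩ := ih #(s.erase v) (by omega) (s.erase v) (by omega) he rfl
    have hlen : l.length = #(s.erase v) := by rw [← hls, List.toFinset_card_of_nodup hl]
    obtain ⟨l', hp, hc'⟩ := exists_chain_insert Hᶜ v l hl hc (by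
      have : #{x ∈ l.toFinset | ¬ Hᶜ.Adj v x} ≤ #{y ∈ s | H.Adj v y} := by
        refine card_le_card fun x => ?_
        rw [hls]
        simp only [mem_filter, mem_erase, compl_adj, not_and, not_not]
        exact fun hx => ⟨hx.1.2, hx.2 hx.1.1.symm⟩
      omega)
    have hvl : v ∉ l' := by
      rw [hp.mem_iff, ← List.mem_toFinset, hls]; simp
    refine ⟨v :: l', List.nodup_cons.2 ⟨hvl, hp.nodup_iff.2 hl⟩, ?_, hc'⟩
    rw [List.toFinset_cons, List.toFinset_eq_of_perm _ _ hp, hls, insert_erase hv]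

end SparseComplement

/-- In the graph `H` of forbidden pairs, a new vertex `none` is joined exactly to `S`. A cycle in
the complement of `H`, cut open at `none`, is a path of `G` with both ends outside `S`. The new
vertex adds 1 to the vertex count and #S to the forbidden pairs. -/
theorem exists_isChain_avoiding {V : Type*} [DecidableEq V] (G : SimpleGraph V)
    (R S : Finset V) (hSR : S ⊆ R) (h : Gᶜ.degreeSumOn R + 2 * #S + 4 ≤ 2 * #R) :
    ∃ L : List V, L.Nodup ∧ L.toFinset = R ∧ L.IsChain G.Adj ∧
      (∀ x ∈ L.head?, x ∉ S) ∧ ∀ x ∈ L.getLast?, x ∉ S := by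
  classical
  let H : SimpleGraph (Option V) :=
    { Adj := fun x y => match x, y with
        | some x, some y => Gᶜ.Adj x y
        | none, some y => y ∈ S
        | some x, none => x ∈ S
        | none, none => False
      symm := ⟨by rintro (_ | x) (_ | y) h <;> first | exact h | exact h.symm⟩
      loopless := ⟨by rintro (_ | x) h; exacts [h, h.ne rfl]⟩ }
  have hnone : none ∉ R.map Function.Embedding.some := by simp
  have hsum : H.degreeSumOn (insert none (R.map Function.Embedding.some))
      = Gᶜ.degreeSumOn R + 2 * #S := by
    rw [degreeSumOn_insert H hnone]
    refine congr_arg₂ (fun x y => x + 2 * y) ?_ ?_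
    · rw [degreeSumOn_eq, sum_map, degreeSumOn_eq]
      refine sum_congr rfl fun x _ => ?_
      rw [filter_map, card_map]
      exact congr_arg card (filter_congr fun y _ => Iff.rfl)
    · rw [filter_map, card_map]
      congr 1
      ext y
      simp only [mem_filter, Function.comp]
      exact ⟨fun h => h.2, fun h => ⟨hSR h, h⟩⟩
  have hcard : #(insert none (R.map Function.Embedding.some)) = #R + 1 := by
    rw [card_insert_of_notMem hnone, card_map]
  obtain ⟨l, hl, hls, hc⟩ := H.exists_cycle_of_degreeSumOn_le _ (by rw [hcard]; omega)
    (by rw [hsum, hcard]; omega)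
  have hmem : none ∈ l := by rw [← List.mem_toFinset, hls]; simp
  obtain ⟨l₁, l₂, rfl⟩ := List.append_of_mem hmem
  have hrot : (l₁ ++ none :: l₂) ~r (none :: (l₂ ++ l₁)) := List.isRotated_append
  have hcyc : Cycle.ofList (l₁ ++ none :: l₂) = Cycle.ofList (none :: (l₂ ++ l₁)) :=
    Quotient.sound hrot
  rw [hcyc, Cycle.chain_coe_cons] at hc
  have hnd := hrot.perm.nodup_iff.1 hl
  rw [List.toFinset_eq_of_perm _ _ hrot.perm] at hls
  generalize l₂ ++ l₁ = m at *
  rw [List.nodup_cons] at hnd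
  obtain ⟨L, rfl⟩ : ∃ L : List V, L.map some = m := by
    refine ⟨m.reduceOption, ?_⟩
    have : ∀ m : List (Option V), none ∉ m → m.reduceOption.map some = m := by
      intro m hm
      induction m with
      | nil => rfl
      | cons a m ih =>
        rcases a with _ | a
        · simp at hm
        · simpa using ih (by simpa using hm)
    exact this m hnd.1
  rw [List.toFinset_cons] at hls
  rw [List.isChain_cons, List.isChain_append, List.isChain_map] at hc
  have hR : L.toFinset = R := by
    ext x
    have := Finset.ext_iff.1 hls (some x)
    simpa using this
  have hLne : L ≠ [] := by
    rintro rfl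
    rw [← hR] at h
    simp at h
  refine ⟨L, List.Nodup.of_map _ hnd.2, hR, hc.2.1.imp fun x y hxy => ?_, ?_, ?_⟩
  · have hxy' : Hᶜ.Adj (some x) (some y) := hxy
    rw [compl_adj] at hxy'
    by_contra hG
    exact hxy'.2 (show Gᶜ.Adj x y from ⟨fun h => hxy'.1 (by rw [h]), hG⟩)
  · intro x hx hxS
    have := hc.1 (some x) (by
      obtain ⟨a, m, rfl⟩ := List.exists_cons_of_ne_nil hLne
      simpa using hx)
    exact this.2 hxS
  · intro x hx hxS
    have := hc.2.2.2 (some x) (by simpa using hx) none (by simp)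
    exact this.2 hxS

/-! ### Hamiltonian properties from few non-edges -/

section Finite

variable {V : Type*} [Fintype V] [DecidableEq V] (G : SimpleGraph V)

omit [Fintype V] [DecidableEq V] in
theorem degreeSumOn_mono (H : SimpleGraph V) {s t : Finset V} (h : s ⊆ t) :
    H.degreeSumOn s ≤ H.degreeSumOn t := by
  classical
  rw [degreeSumOn_eq, degreeSumOn_eq]
  exact (sum_le_sum fun _ _ => card_le_card (filter_subset_filter _ h)).trans
    (sum_le_sum_of_subset h)

/-- If the complement of `G` is sparse, then `a` and `b` are joined by a path whose inner vertices
are exactly the vertices outside of `T`. -/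
theorem exists_isChain_through_compl (T : Finset V) {a b : V} (ha : a ∈ T) (hb : b ∈ T)
    (h : Gᶜ.degreeSumOn univ + 4 ≤ 2 * #Tᶜ) :
    ∃ L : List V, L.Nodup ∧ L.toFinset = Tᶜ ∧ (a :: (L ++ [b])).IsChain G.Adj := by
  classical
  let S : Finset V := {y ∈ Tᶜ | ¬ (G.Adj a y ∧ G.Adj b y)}
  -- Each vertex of `S`, unfit to be an end of the path, has a non-edge to `T`. These non-edges are
  -- counted from both ends over all vertices, but not at all inside the complement of `T`.
  have hsum : Gᶜ.degreeSumOn Tᶜ + 2 * #S ≤ Gᶜ.degreeSumOn univ := by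
    have hS : ∀ y ∈ S, ∃ x ∈ T, Gᶜ.Adj x y := by
      intro y hy
      simp only [S, mem_filter, mem_compl, not_and_or] at hy
      rcases hy.2 with h | h
      · exact ⟨a, ha, fun e => hy.1 (e ▸ ha), h⟩
      · exact ⟨b, hb, fun e => hy.1 (e ▸ hb), h⟩
    have h1 : ∑ x ∈ Tᶜ, (#{y ∈ Tᶜ | Gᶜ.Adj x y} + if x ∈ S then 1 else 0)
        ≤ ∑ x ∈ Tᶜ, #{y | Gᶜ.Adj x y} := by
      refine sum_le_sum fun x _ => ?_
      split_ifs with hx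
      · obtain ⟨z, hz, hzx⟩ := hS x hx
        refine card_lt_card (Finset.ssubset_iff_subset_ne.2
          ⟨filter_subset_filter _ (subset_univ _), fun e => ?_⟩)
        have : z ∈ ({y ∈ Tᶜ | Gᶜ.Adj x y} : Finset V) := by
          rw [e]; simpa [adj_comm] using hzx
        simp [hz] at this
      · exact card_le_card (filter_subset_filter _ (subset_univ _))
    have h2 : #S ≤ ∑ x ∈ T, #{y | Gᶜ.Adj x y} := by
      refine (card_le_card fun y hy => ?_).trans card_biUnion_le
      obtain ⟨x, hx, hxy⟩ := hS y hy
      exact mem_biUnion.2 ⟨x, hx, by simpa using hxy⟩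
    have h3 : ∑ x ∈ Tᶜ, (if x ∈ S then 1 else 0) = #S := by
      rw [← card_filter]
      congr 1
      ext x
      simp [S]
    have h4 := sum_add_sum_compl T fun x => #{y | Gᶜ.Adj x y}
    rw [sum_add_distrib, h3] at h1
    rw [degreeSumOn_eq, degreeSumOn_eq]
    omega
  obtain ⟨L, hL, hLT, hch, hh, ht⟩ := G.exists_isChain_avoiding Tᶜ S (filter_subset _ _)
    (by omega)
  refine ⟨L, hL, hLT, ?_⟩
  have hS : ∀ x ∈ L, x ∉ S → G.Adj a x ∧ G.Adj b x := by
    intro x hx hxS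
    rw [← List.mem_toFinset, hLT] at hx
    simpa only [S, mem_filter, hx, true_and, not_not] using hxS
  have hne : L ≠ [] := by
    rintro rfl
    rw [← hLT] at h
    simp at h
  rw [List.isChain_cons, List.isChain_append]
  refine ⟨fun x hx => ?_, hch, by simp, fun x hx y hy => ?_⟩
  · rw [List.head?_append_of_ne_nil _ hne] at hx
    exact (hS x (List.mem_of_mem_head? hx) (hh x hx)).1
  · simp only [List.head?_cons, Option.mem_def, Option.some.injEq] at hy
    exact hy ▸ (hS x (List.mem_of_mem_getLast? hx) (ht x hx)).2.symm

omit [Fintype V] [DecidableEq V] in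
theorem Walk.exists_support_eq {G : SimpleGraph V} {a b : V} {L : List V}
    (h : (a :: (L ++ [b])).IsChain G.Adj) : ∃ q : G.Walk a b, q.support = a :: (L ++ [b]) :=
  ⟨(Walk.ofSupport _ (List.cons_ne_nil _ _) h).copy (List.head_cons ..) (by simp), by
    rw [Walk.support_copy, Walk.support_ofSupport]⟩

theorem isTraceable_of_degreeSumOn_le [Nonempty V]
    (h : Gᶜ.degreeSumOn univ + 4 ≤ 2 * Fintype.card V) : G.IsTraceable := by
  obtain ⟨L, hL, hLV, hch, -, -⟩ := G.exists_isChain_avoiding univ ∅ (subset_univ _)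
    (by simpa using h)
  have hne : L ≠ [] := by
    rintro rfl
    exact univ_nonempty.ne_empty hLV.symm
  refine ⟨_, _, Walk.ofSupport L hne hch, ?_⟩
  refine Walk.IsPath.isHamiltonian_of_mem (Walk.IsPath.mk' (by simpa using hL)) fun w => ?_
  rw [Walk.support_ofSupport, ← List.mem_toFinset, hLV]
  exact mem_univ w

theorem isHamiltonianConnected_of_degreeSumOn_le
    (h : Gᶜ.degreeSumOn univ + 8 ≤ 2 * Fintype.card V) : G.IsHamiltonianConnected := by
  intro u v huv
  obtain ⟨L, hL, hLT, hch⟩ := G.exists_isChain_through_compl {u, v} (a := u) (b := v)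
    (by simp) (by simp) (by rw [card_compl, card_pair huv]; omega)
  obtain ⟨q, hq⟩ := Walk.exists_support_eq hch
  have hmem : ∀ x, x ∈ L ↔ x ≠ u ∧ x ≠ v := fun x => by
    rw [← List.mem_toFinset, hLT]; simp
  refine ⟨q, Walk.IsPath.isHamiltonian_of_mem (Walk.IsPath.mk' ?_) fun w => ?_⟩
  · rw [hq]
    simp only [List.nodup_cons, List.mem_append, List.mem_singleton, huv, hmem,
      List.nodup_append, hL]
    grind
  · rw [hq]
    simp only [List.mem_cons, List.mem_append, hmem]
    simp
    tauto

theorem isPathHamiltonian_of_degreeSumOn_le (k : ℕ)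
    (h : Gᶜ.degreeSumOn univ + 6 + 2 * k ≤ 2 * Fintype.card V) : G.IsPathHamiltonian k := by
  intro u v p hp hk
  have hT : #p.support.toFinset = p.length + 1 := by
    rw [List.toFinset_card_of_nodup hp.support_nodup, Walk.length_support]
  have hTn : #p.support.toFinset + #p.support.toFinsetᶜ = Fintype.card V := card_add_card_compl _
  obtain ⟨L, hL, hLT, hch⟩ := G.exists_isChain_through_compl p.support.toFinset (a := v) (b := u)
    (by simp) (by simp) (by omega)
  have hmem : ∀ x, x ∈ L ↔ x ∉ p.support := fun x => by
    rw [← List.mem_toFinset, hLT]; simp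
  have hlen : L.length = #p.support.toFinsetᶜ := by rw [← hLT, List.toFinset_card_of_nodup hL]
  rcases L with _ | ⟨x, L⟩
  · simp at hlen; omega
  rw [List.cons_append, List.isChain_cons_cons] at hch
  obtain ⟨q, hq⟩ := Walk.exists_support_eq hch.2
  have hqp : q.IsPath := by
    refine Walk.IsPath.mk' ?_
    rw [hq, ← List.cons_append, List.nodup_append]
    refine ⟨hL, by simp, fun a ha b hb => ?_⟩
    rintro rfl
    simp only [List.mem_singleton] at hb
    exact (hmem a).1 ha (by simp [hb])
  -- The edge from `v` to `x` is given to the first piece. This covers a one-vertex `p`, where `u =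
  -- v` and the way back from `v` to `u` would not itself be a path.
  have hpx : (p.concat hch.1).IsPath := hp.concat ((hmem x).1 (by simp)) hch.1
  have hql : q.length = L.length + 1 := by
    have := congr_arg List.length hq
    simp at this
    omega
  simp only [List.length_cons] at hlen
  refine ⟨u, (p.concat hch.1).append q, ?_, ?_⟩
  · rw [Walk.isHamiltonianCycle_iff_isCycle_and_length_eq]
    refine ⟨hpx.isCycle_append hqp ?_ (Or.inr (by omega)), ?_⟩
    · rw [hq]
      intro z hz hz'
      have hz2 : z ∈ p.support.tail ∨ z = x := by
        rw [Walk.support_concat] at hz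
        rw [← Walk.cons_tail_support p] at hz
        simpa [List.concat_eq_append] using hz
      simp only [List.tail_cons, List.mem_append, List.mem_singleton] at hz'
      have hpn := hp.support_nodup
      rw [← Walk.cons_tail_support p, List.nodup_cons] at hpn
      rcases hz2 with h1 | rfl <;> rcases hz' with h2 | rfl
      · exact (hmem z).1 (by simp [h2]) (List.mem_of_mem_tail h1)
      · exact hpn.1 h1
      · exact (List.nodup_cons.1 hL).1 h2
      · exact (hmem z).1 (by simp) (by simp)
    · rw [Walk.length_append, Walk.length_concat]
      omega
  · rw [Walk.toSubgraph_append, Walk.concat_eq_append, Walk.toSubgraph_append]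
    exact le_sup_left.trans le_sup_left

theorem isHamiltonian_of_degreeSumOn_le
    (h : Gᶜ.degreeSumOn univ + 6 ≤ 2 * Fintype.card V) : G.IsHamiltonian := by
  intro _
  obtain ⟨v⟩ : Nonempty V := Fintype.card_pos_iff.1 (by omega)
  obtain ⟨a, c, hc, -⟩ := G.isPathHamiltonian_of_degreeSumOn_le 0 h v v Walk.nil (by simp)
    (by simp)
  exact ⟨a, c, hc⟩

/-- Deleting vertices creates no non-edges, and the slack `2 * k` pays for the lost vertices. -/
theorem isKHamiltonian_of_degreeSumOn_le (k : ℕ)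
    (h : Gᶜ.degreeSumOn univ + 6 + 2 * k ≤ 2 * Fintype.card V) : G.IsKHamiltonian k := by
  classical
  intro s hs
  apply isHamiltonian_of_degreeSumOn_le
  have h1 : (G.induce (↑(sᶜ) : Set V))ᶜ.degreeSumOn univ = Gᶜ.degreeSumOn sᶜ := by
    have key : ∀ f : V → ℕ, ∑ x : (↑(sᶜ) : Set V), f x = ∑ x ∈ sᶜ, f x := fun f =>
      (sum_subtype sᶜ (fun x => by simp) f).symm
    rw [degreeSumOn_eq, degreeSumOn_eq, ← key]
    refine sum_congr rfl fun x _ => ?_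
    rw [card_filter, card_filter, ← key]
    refine sum_congr rfl fun y _ => ?_
    simp only [compl_adj, comap_adj, Function.Embedding.subtype_apply, ne_eq, Subtype.ext_iff]
  have h2 : Fintype.card (↑(sᶜ) : Set V) = Fintype.card V - #s := by
    rw [← card_compl, ← Fintype.card_coe]
    exact Fintype.card_congr (Equiv.refl _)
  have h3 := Gᶜ.degreeSumOn_mono (subset_univ sᶜ)
  rw [h1]
  omega

theorem degreeSumOn_compl_add_ncard_edgeSet :
    Gᶜ.degreeSumOn univ + 2 * G.edgeSet.ncard = Fintype.card V * (Fintype.card V - 1) := by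
  classical
  rw [← coe_edgeFinset, Set.ncard_coe_finset, ← sum_degrees_eq_twice_card_edges, degreeSumOn_eq,
    ← sum_add_distrib, sum_const_nat, card_univ]
  intro x _
  have : #{y | Gᶜ.Adj x y} = Gᶜ.degree x := by
    rw [← card_neighborFinset_eq_degree, neighborFinset_eq_filter]
  rw [degree_compl] at this
  have := G.degree_lt_card_verts x
  omega

/-- Since C(n, 2) - C(n-1, 2) = n - 1, at most n - 2 - j pairs are non-edges. -/
theorem degreeSumOn_compl_of_lt_ncard_edgeSet {j : ℕ}
    (h : (Fintype.card V - 1).choose 2 + j < G.edgeSet.ncard) :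
    Gᶜ.degreeSumOn univ + 4 + 2 * j ≤ 2 * Fintype.card V := by
  have h1 := G.degreeSumOn_compl_add_ncard_edgeSet
  generalize Fintype.card V = n at *
  rcases n with _ | _ | n
  · simp at h1; omega
  · simp at h1; omega
  · have h3 : (n + 1).choose 2 * 2 = n * (n + 1) := by
      have := Nat.add_one_mul_choose_eq n 1
      simp at this
      linarith
    simp only [Nat.add_sub_cancel] at *
    nlinarith

end Finite

/-! ### Invariance of clique counts -/

section NumCliques

variable {V W : Type*} {G : SimpleGraph V} {H : SimpleGraph W}

/-- Vertices outside the range may exist as long as no `t`-clique meets them. For `t ≥ 2` this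
allows isolated vertices to be dropped. -/
theorem numCliques_eq_of_embedding (f : G ↪g H) (t : ℕ)
    (h : ∀ s ∈ H.cliqueSet t, ∀ x ∈ s, x ∈ Set.range f) : G.numCliques t = H.numCliques t := by
  classical
  rw [numCliques, numCliques,
    ← Set.ncard_image_of_injective _ (Finset.map_injective f.toEmbedding)]
  congr 1
  ext s
  simp only [Set.mem_image, mem_cliqueSet_iff]
  constructor
  · rintro ⟨s, hs, rfl⟩
    exact (hs.map (f := f.toEmbedding)).mono (by
      rw [map_le_iff_le_comap]
      exact fun x y hxy => f.map_rel_iff.2 hxy)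
  · intro hs
    obtain ⟨s, rfl⟩ : ∃ s' : Finset V, s'.map f.toEmbedding = s := by
      refine ⟨s.preimage f f.injective.injOn, ?_⟩
      ext x
      simp only [mem_map, mem_preimage]
      constructor
      · rintro ⟨y, hy, rfl⟩; exact hy
      · intro hx
        obtain ⟨y, rfl⟩ := h s hs x hx
        exact ⟨y, hx, rfl⟩
    refine ⟨s, ⟨fun x hx y hy hxy => ?_, by simpa using hs.2⟩, rfl⟩
    exact f.map_rel_iff.1 (hs.1 (by simpa using hx) (by simpa using hy)
      (f.injective.ne hxy))

theorem numCliques_congr (f : G ≃g H) (t : ℕ) : G.numCliques t = H.numCliques t :=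
  numCliques_eq_of_embedding f.toEmbedding t fun _ _ x _ => f.surjective x

theorem exists_adj_of_mem_clique {t : ℕ} (ht : 2 ≤ t) {s : Finset V} (hs : s ∈ G.cliqueSet t)
    {x : V} (hx : x ∈ s) : ∃ y ∈ s, G.Adj x y := by
  obtain ⟨y, hy, hyx⟩ := exists_mem_ne (by rw [hs.2]; omega) x
  exact ⟨y, hy, hs.1 hx hy hyx.symm⟩

theorem ncard_edgeSet_congr (f : G ≃g H) : G.edgeSet.ncard = H.edgeSet.ncard :=
  Nat.card_congr f.mapEdgeSet

end NumCliques

/-! ### Structure of the colex graph -/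

section Colex

theorem numCliques_colexGraph (m : ℕ) {t : ℕ} (ht : 2 ≤ t) :
    (colexGraph m).numCliques t = (colexGraphNat m).numCliques t :=
  numCliques_eq_of_embedding (Embedding.induce _) t fun s hs x hx => by
    obtain ⟨y, -, hy⟩ := exists_adj_of_mem_clique ht hs hx
    exact ⟨⟨x, y, hy⟩, rfl⟩

theorem toColex_pair_lt_iff {a b i j : ℕ} (hab : a < b) (hij : i < j) :
    toColex ({a, b} : Finset ℕ) < toColex {i, j} ↔ b < j ∨ b = j ∧ a < i := by
  rw [Finset.Colex.toColex_lt_toColex_iff_exists_forall_lt]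
  simp only [mem_insert, mem_singleton]
  constructor
  · rintro ⟨x, hx, h1, h2⟩
    have ha := h2 a (Or.inl rfl)
    have hb := h2 b (Or.inr rfl)
    omega
  · rintro (h | ⟨rfl, h⟩)
    · exact ⟨j, by simp, by omega, by grind⟩
    · exact ⟨i, by simp, by omega, by grind⟩

/-- The predecessors are the pairs below `j` and the pairs `{a, j}` with `a < i`. -/
theorem encard_colex_predecessors {i j : ℕ} (hij : i < j) :
    {Q : Finset ℕ | Q.card = 2 ∧ toColex Q < toColex ({i, j} : Finset ℕ)}.encard
      = (j.choose 2 + i : ℕ) := by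
  have hset : {Q : Finset ℕ | Q.card = 2 ∧ toColex Q < toColex ({i, j} : Finset ℕ)}
      = ↑(powersetCard 2 (range j) ∪ (range i).image fun a => {a, j}) := by
    ext Q
    simp only [Set.mem_ofPred_eq, coe_union, Set.mem_union, mem_coe, mem_powersetCard, mem_image,
      mem_range]
    constructor
    · rintro ⟨hQ, hlt⟩
      obtain ⟨a, b, hab, rfl⟩ := card_eq_two.1 hQ
      rcases hab.lt_or_gt with h | h
      · rcases (toColex_pair_lt_iff h hij).1 hlt with h' | ⟨rfl, h'⟩
        · exact Or.inl ⟨by grind, hQ⟩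
        · exact Or.inr ⟨a, h', rfl⟩
      · rw [pair_comm] at hlt
        rcases (toColex_pair_lt_iff h hij).1 hlt with h' | ⟨rfl, h'⟩
        · exact Or.inl ⟨by grind, hQ⟩
        · exact Or.inr ⟨b, h', pair_comm _ _⟩
    · rintro (⟨hsub, hQ⟩ | ⟨a, ha, rfl⟩)
      · refine ⟨hQ, ?_⟩
        obtain ⟨a, b, hab, rfl⟩ := card_eq_two.1 hQ
        have ha : a < j := mem_range.1 (hsub (by simp))
        have hb : b < j := mem_range.1 (hsub (by simp))
        rcases hab.lt_or_gt with h | h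
        · exact (toColex_pair_lt_iff h hij).2 (Or.inl hb)
        · rw [pair_comm]
          exact (toColex_pair_lt_iff h hij).2 (Or.inl ha)
      · have haj : a < j := by omega
        exact ⟨card_pair haj.ne, (toColex_pair_lt_iff haj hij).2 (Or.inr ⟨rfl, ha⟩)⟩
  rw [hset, Set.encard_coe_eq_coe_finsetCard, card_union_of_disjoint, card_powersetCard,
    card_range, card_image_of_injOn, card_range]
  · intro a ha b hb hab
    have : a ∈ ({b, j} : Finset ℕ) := by
      rw [← show ({a, j} : Finset ℕ) = {b, j} from hab]; simp
    simp at ha hb this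
    omega
  · rw [Finset.disjoint_left]
    rintro Q hQ hQ'
    obtain ⟨a, -, rfl⟩ := mem_image.1 hQ'
    have := (mem_powersetCard.1 hQ).1 (mem_insert_of_mem (mem_singleton_self j))
    simp at this

theorem colexGraphNat_adj_iff_of_lt {m i j : ℕ} (hij : i < j) :
    (colexGraphNat m).Adj i j ↔ j.choose 2 + i < m := by
  change i ≠ j ∧ ({i, j} : Finset ℕ).card = 2 ∧ _ ↔ _
  rw [encard_colex_predecessors hij, Nat.cast_lt]
  simp [hij.ne]

/-- Colex order lists all pairs below `N` first, then the `N` pairs with larger element `N`; as `d ≤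
N`, the list stops within the latter. -/
theorem choose_two_add_lt_iff {N d i j : ℕ} (hd : d ≤ N) (hij : i < j) :
    j.choose 2 + i < N.choose 2 + d ↔ j < N ∨ j = N ∧ i < d := by
  have hs : ∀ k : ℕ, (k + 1).choose 2 = k.choose 2 + k := fun k => by
    rw [Nat.choose_succ_succ' k 1, Nat.choose_one_right, add_comm]
  rcases lt_trichotomy j N with h | rfl | h
  · have := hs j
    have := Nat.choose_le_choose 2 (show j + 1 ≤ N from h)
    simp only [h, true_or, iff_true]
    omega
  · simp
  · have := hs N
    have := Nat.choose_le_choose 2 (show N + 1 ≤ j from h)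
    simp only [h.not_gt, h.ne', false_and, or_false, iff_false]
    omega

theorem colexGraphNat_adj_iff {N d i j : ℕ} (hd : d ≤ N) :
    (colexGraphNat (N.choose 2 + d)).Adj i j ↔
      i ≠ j ∧ (i < N ∧ j < N ∨ j = N ∧ i < d ∨ i = N ∧ j < d) := by
  rcases lt_trichotomy i j with h | rfl | h
  · rw [colexGraphNat_adj_iff_of_lt h, choose_two_add_lt_iff hd h]
    omega
  · simp
  · rw [adj_comm, colexGraphNat_adj_iff_of_lt h, choose_two_add_lt_iff hd h]
    omega

theorem support_colexGraphNat {n d : ℕ} (hd : 1 ≤ d) (hdn : d + 1 ≤ n) :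
    (colexGraphNat ((n - 1).choose 2 + d)).support = ↑(range n) := by
  ext i
  simp only [mem_support, colexGraphNat_adj_iff (show d ≤ n - 1 by omega), coe_range, Set.mem_Iio]
  constructor
  · rintro ⟨j, h⟩; omega
  · intro hi
    by_cases h : i = 0
    · exact ⟨n - 1, by omega⟩
    · exact ⟨0, by omega⟩

theorem isCompletePlusVertex_colexGraph {n d : ℕ} (hd : 1 ≤ d) (hdn : d + 1 ≤ n) :
    (colexGraph ((n - 1).choose 2 + d)).IsCompletePlusVertex d := by
  have hs := support_colexGraphNat hd hdn
  have hmem : ∀ i, i ∈ (colexGraphNat ((n - 1).choose 2 + d)).support ↔ i < n := fun i => by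
    rw [hs]; simp
  have hadj : ∀ i j, _ ↔ _ := fun i j =>
    colexGraphNat_adj_iff (i := i) (j := j) (show d ≤ n - 1 by omega)
  refine ⟨⟨n - 1, (hmem _).2 (by omega)⟩, ?_, fun x y hx hy hxy => ?_⟩
  · rw [← Subtype.val_injective.encard_image]
    have : Subtype.val '' ((colexGraph ((n - 1).choose 2 + d)).neighborSet
        ⟨n - 1, (hmem _).2 (by omega)⟩) = ↑(range d) := by
      ext i
      simp only [Set.mem_image, mem_neighborSet, colexGraph, comap_adj, Subtype.exists,
        Function.Embedding.subtype_apply, hadj, hmem, coe_range, Set.mem_Iio]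
      constructor
      · rintro ⟨j, h1, h2, rfl⟩; omega
      · intro h; exact ⟨i, by omega, (by simp only [true_and]; omega), rfl⟩
    rw [this, Set.encard_coe_eq_coe_finsetCard, card_range]
  · have h1 := (hmem _).1 x.2
    have h2 := (hmem _).1 y.2
    rw [ne_eq, Subtype.ext_iff] at hx hy hxy
    simp only [colexGraph, comap_adj, Function.Embedding.subtype_apply, hadj]
    simp only at hx hy
    omega

theorem numCliques_colexGraphNat_choose_two (N : ℕ) {t : ℕ} (ht : 2 ≤ t) :
    (⊤ : SimpleGraph (Fin N)).numCliques t = (colexGraphNat (N.choose 2)).numCliques t := by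
  have hadj : ∀ i j, _ ↔ _ := fun i j => colexGraphNat_adj_iff (i := i) (j := j) (Nat.zero_le N)
  simp only [add_zero] at hadj
  refine numCliques_eq_of_embedding ⟨Fin.valEmbedding, ?_⟩ t fun s hs x hx => ?_
  · intro a b
    simp only [hadj, Fin.valEmbedding_apply, top_adj, ne_eq, Fin.ext_iff]
    omega
  · obtain ⟨y, -, hy⟩ := exists_adj_of_mem_clique ht hs hx
    rw [hadj] at hy
    exact ⟨⟨x, by omega⟩, rfl⟩

end Colex

/-! ### The clique bound from Kruskal–Katona -/

section KruskalKatona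

open Finset.Colex

open scoped FinsetFamily

/-- Adding the colex-least missing `r`-set to an initial segment gives an initial segment. -/
theorem _root_.Finset.Colex.exists_isInitSeg_card_eq {α : Type*} [Fintype α] [LinearOrder α]
    (r : ℕ) {c : ℕ} (hc : c ≤ (Fintype.card α).choose r) :
    ∃ 𝒞 : Finset (Finset α), IsInitSeg 𝒞 r ∧ #𝒞 = c := by
  induction c with
  | zero => exact ⟨∅, by simp⟩
  | succ c ih =>
    obtain ⟨𝒞, h𝒞, hcard⟩ := ih (by omega)
    have hne : (powersetCard r univ \ 𝒞).Nonempty := by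
      rw [sdiff_nonempty]
      intro hsub
      have := card_le_card hsub
      rw [card_powersetCard, card_univ] at this
      omega
    obtain ⟨s, hs, hmin⟩ := exists_min_image _ toColex hne
    rw [mem_sdiff, mem_powersetCard] at hs
    refine ⟨insert s 𝒞, ⟨?_, ?_⟩, by rw [card_insert_of_notMem hs.2, hcard]⟩
    · intro t ht
      rcases mem_insert.1 (mem_coe.1 ht) with rfl | ht
      · exact hs.1.2
      · exact h𝒞.1 ht
    · rintro u v hu ⟨hlt, hv⟩
      rw [mem_insert] at hu ⊢
      rcases hu with rfl | hu
      · by_contra hcon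
        push Not at hcon
        exact (hmin v (by simp [hv, hcon.2])).not_gt hlt
      · exact Or.inr (h𝒞.2 hu ⟨hlt, hv⟩)

theorem _root_.Finset.Colex.IsInitSeg.shadow_iterate {α : Type*} [Finite α] [LinearOrder α]
    {𝒜 : Finset (Finset α)} {r : ℕ} (h : IsInitSeg 𝒜 r) (k : ℕ) :
    IsInitSeg (∂^[k] 𝒜) (r - k) := by
  induction k with
  | zero => simpa
  | succ k ih =>
    rw [Function.iterate_succ_apply', ← Nat.sub_sub]
    exact ih.shadow

/-- An initial segment of the pairs in `Fin n` with at most `m` members consists of pairs among the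
first `m` pairs in `ℕ`. -/
theorem map_mem_colexPairs_of_isInitSeg {n m : ℕ} {𝒬 : Finset (Finset (Fin n))}
    (h : IsInitSeg 𝒬 2) (hm : #𝒬 ≤ m) {P : Finset (Fin n)} (hP : P ∈ 𝒬) :
    P.map Fin.valEmbedding ∈ colexPairs m := by
  refine ⟨by rw [card_map]; exact h.1 hP, ?_⟩
  have hsub : {Q : Finset ℕ | Q.card = 2 ∧ toColex Q < toColex (P.map Fin.valEmbedding)} ⊆
      ↑((𝒬.erase P).image fun Q => Q.map Fin.valEmbedding) := by
    rintro Q ⟨hQ, hlt⟩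
    -- A colex predecessor of a set with all elements below `n` also has all its elements below `n`,
    -- so it comes from `Fin n`.
    have hlt' : ∀ b ∈ Q, b < n := forall_lt_mono hlt.le (by simp)
    obtain ⟨R, rfl⟩ : ∃ R : Finset (Fin n), R.map Fin.valEmbedding = Q :=
      ⟨attachFin Q hlt', map_valEmbedding_attachFin hlt'⟩
    rw [card_map] at hQ
    rw [map_eq_image, map_eq_image] at hlt
    have hRP := (toColex_image_lt_toColex_image Fin.val_strictMono).1 hlt
    simp only [coe_image, Set.mem_image, mem_coe, mem_erase]
    exact ⟨R, ⟨fun e => hRP.ne (by rw [e]), h.2 hP ⟨hRP, hQ⟩⟩, rfl⟩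
  refine (Set.encard_le_encard hsub).trans_lt ?_
  rw [Set.encard_coe_eq_coe_finsetCard, Nat.cast_lt]
  have := card_image_le (s := 𝒬.erase P) (f := fun Q => Q.map Fin.valEmbedding)
  have := card_erase_lt_of_mem hP
  omega

/-- Needed because `ncard` is 0 on infinite sets and so is monotone only into finite ones. -/
theorem finite_cliqueSet_colexGraphNat (m : ℕ) {t : ℕ} (ht : 2 ≤ t) :
    ((colexGraphNat m).cliqueSet t).Finite := by
  have key : ∀ i j, i < j → (colexGraphNat m).Adj i j → j < m + 2 := by
    intro i j hij h
    rw [colexGraphNat_adj_iff_of_lt hij] at h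
    rcases j with _ | j
    · omega
    · rw [Nat.choose_succ_succ' j 1, Nat.choose_one_right] at h
      omega
  refine (Finset.finite_toSet (range (m + 2)).powerset).subset fun s hs => ?_
  simp only [mem_coe, mem_powerset]
  intro x hx
  obtain ⟨y, -, hy⟩ := exists_adj_of_mem_clique ht hs hx
  rw [mem_range]
  rcases hy.ne.lt_or_gt with h | h
  · exact h.trans (key x y h hy)
  · exact key y x h hy.symm

/-- Replace the `t`-cliques by an initial segment `𝒞` of equal size. The pairs inside cliques are
edges, so by Kruskal–Katona at most `m` pairs lie inside members of `𝒞`. These pairs form an initial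
segment, hence are edges of the colex graph, and every member of `𝒞` is a clique there. -/
theorem numCliques_le_colexGraphNat_fin {n m t : ℕ} (ht : 2 ≤ t) (G : SimpleGraph (Fin n))
    (hm : G.edgeSet.ncard ≤ m) : G.numCliques t ≤ (colexGraphNat m).numCliques t := by
  classical
  have h𝒜 : G.numCliques t = #(G.cliqueFinset t) := by
    rw [numCliques, ← coe_cliqueFinset, Set.ncard_coe_finset]
  have hsized : (G.cliqueFinset t : Set (Finset (Fin n))).Sized t := fun s hs =>
    ((G.mem_cliqueFinset_iff).1 hs).2
  obtain ⟨𝒞, h𝒞, hcard⟩ := exists_isInitSeg_card_eq (α := Fin n) t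
    (c := #(G.cliqueFinset t)) hsized.card_le
  have hkk := iterated_kk (k := t - 2) hsized hcard.le h𝒞
  have hshadow : ∂^[t - 2] (G.cliqueFinset t) ⊆ G.edgeFinset.image Sym2.toFinset := by
    intro P hP
    obtain ⟨s, hs, hPs, hsP⟩ := mem_shadow_iterate_iff_exists_sdiff.1 hP
    rw [mem_cliqueFinset_iff] at hs
    rw [card_sdiff_of_subset hPs, hs.2] at hsP
    have hle := card_le_card hPs
    rw [hs.2] at hle
    obtain ⟨a, b, hab, rfl⟩ := card_eq_two.1 (show #P = 2 by omega)
    refine mem_image.2 ⟨s(a, b), ?_, Sym2.toFinset_mk_eq⟩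
    rw [mem_edgeFinset, mem_edgeSet]
    exact hs.1 (hPs (by simp)) (hPs (by simp)) hab
  have hedge : #(∂^[t - 2] 𝒞) ≤ m := by
    refine (hkk.trans ((card_le_card hshadow).trans card_image_le)).trans ?_
    rwa [← Set.ncard_coe_finset, coe_edgeFinset]
  have hinit := h𝒞.shadow_iterate (t - 2)
  rw [show t - (t - 2) = 2 by omega] at hinit
  rw [h𝒜, ← hcard, numCliques, ← card_image_of_injective 𝒞 (Finset.map_injective Fin.valEmbedding),
    ← Set.ncard_coe_finset]
  refine Set.ncard_le_ncard ?_ (finite_cliqueSet_colexGraphNat m ht)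
  intro s hs
  obtain ⟨s, hs', rfl⟩ := mem_image.1 (mem_coe.1 hs)
  clear hs
  refine ⟨?_, by rw [card_map]; exact h𝒞.1 hs'⟩
  rw [coe_map]
  rintro _ ⟨x, hx, rfl⟩ _ ⟨y, hy, rfl⟩ hxy
  refine ⟨hxy, ?_⟩
  have hne : x ≠ y := fun e => hxy (by rw [e])
  have hsub : {x, y} ⊆ s := by
    simpa [insert_subset_iff] using And.intro hx hy
  have := map_mem_colexPairs_of_isInitSeg hinit hedge (P := {x, y})
    (mem_shadow_iterate_iff_exists_sdiff.2 ⟨s, hs', hsub, by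
      rw [card_sdiff_of_subset hsub, h𝒞.1 hs', card_pair hne]⟩)
  simpa using this

/-- Among all graphs with at most `m` edges the colex graph has the most `t`-cliques. -/
theorem numCliques_le_colexGraphNat {V : Type*} [Finite V] {m t : ℕ} (ht : 2 ≤ t)
    (G : SimpleGraph V) (hm : G.edgeSet.ncard ≤ m) :
    G.numCliques t ≤ (colexGraphNat m).numCliques t := by
  have f := Iso.map (Finite.equivFin V) G
  rw [numCliques_congr f]
  exact numCliques_le_colexGraphNat_fin ht _ (by rwa [← ncard_edgeSet_congr f])

end KruskalKatona

theorem IsCompletePlusVertex.of_iso {V W : Type*} {G : SimpleGraph V} {H : SimpleGraph W}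
    (f : G ≃g H) {d : ℕ} (h : H.IsCompletePlusVertex d) : G.IsCompletePlusVertex d := by
  obtain ⟨w, hw, hadj⟩ := h
  refine ⟨f.symm w, ?_, fun x y hx hy hxy => f.map_rel_iff.1 (hadj _ _ ?_ ?_ ?_)⟩
  · rw [← hw, ← f.symm.injective.encard_image]
    congr 1
    ext x
    simp only [mem_neighborSet, Set.mem_image]
    constructor
    · intro hx
      exact ⟨f x, by simpa using f.map_rel_iff.2 hx, by simp⟩
    · rintro ⟨y, hy, rfl⟩
      exact f.symm.map_rel_iff.2 hy
  · rintro rfl; simp at hx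
  · rintro rfl; simp at hy
  · exact f.injective.ne hxy

/-! ### Why a vertex of small degree blocks each property -/

section Obstructions

variable {V : Type*} [Fintype V] [DecidableEq V] {G : SimpleGraph V}

theorem not_isTraceable_of_isolated {w : V} (hw : ∀ x, ¬ G.Adj w x)
    (h : 2 ≤ Fintype.card V) : ¬ G.IsTraceable := by
  rintro ⟨u, v, p, hp⟩
  have : Nontrivial V := Fintype.one_lt_card_iff_nontrivial.1 h
  obtain ⟨z, hz⟩ := exists_ne w
  have hr : G.Reachable w z :=
    (p.takeUntil w (hp.mem_support w)).reachable.symm.trans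
      (p.takeUntil z (hp.mem_support z)).reachable
  obtain ⟨q⟩ := hr
  cases q with
  | nil => exact hz rfl
  | cons h _ => exact hw _ h

omit [Fintype V] in
theorem Walk.IsHamiltonianCycle.ncard_neighborSet {a : V} {c : G.Walk a a}
    (hc : c.IsHamiltonianCycle) (x : V) : (c.toSubgraph.neighborSet x).ncard = 2 :=
  hc.isCycle.ncard_neighborSet_toSubgraph_eq_two (hc.mem_support x)

theorem not_isHamiltonian_of_encard_neighborSet_le_one {w : V}
    (hw : (G.neighborSet w).encard ≤ 1) (h : Fintype.card V ≠ 1) : ¬ G.IsHamiltonian := by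
  intro hG
  obtain ⟨a, c, hc⟩ := hG h
  have h1 : (c.toSubgraph.neighborSet w).encard ≤ (G.neighborSet w).encard :=
    Set.encard_le_encard (c.toSubgraph.neighborSet_subset w)
  rw [← (Set.toFinite (c.toSubgraph.neighborSet w)).cast_ncard_eq, hc.ncard_neighborSet] at h1
  exact absurd (h1.trans hw) (by norm_num)

/-- A Hamiltonian cycle that contains a path through exactly the neighbours of `w` visits no further
vertices. -/
theorem Walk.IsHamiltonianCycle.adj_of_path_through_neighborSet {a w u v : V} {c : G.Walk a a}
    (hc : c.IsHamiltonianCycle) {p : G.Walk u v} (hp : p.IsPath)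
    (hpc : p.toSubgraph ≤ c.toSubgraph) (hpw : ∀ x, x ∈ p.support ↔ G.Adj w x)
    {z : V} (hz : z ≠ w) : G.Adj w z := by
  by_contra hzw
  have hsub : ∀ x, p.toSubgraph.neighborSet x ⊆ c.toSubgraph.neighborSet x := fun x y hy =>
    hpc.2 hy
  have hwp : w ∉ p.support := fun h => G.irrefl ((hpw w).1 h)
  have hpmem : ∀ x y, y ∈ p.toSubgraph.neighborSet x → y ∈ p.support := fun x y hy =>
    (Walk.mem_verts_toSubgraph p).1 (p.toSubgraph.edge_vert (Subgraph.Adj.symm hy))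
  -- An inner vertex of `p` already has both of its cycle edges on `p`, so in the cycle `w` can be
  -- joined only to the ends of `p`.
  have hint : ∀ i, i ≠ 0 → i < p.length →
      p.toSubgraph.neighborSet (p.getVert i) = c.toSubgraph.neighborSet (p.getVert i) :=
    fun i h0 hi => Set.eq_of_subset_of_ncard_le (hsub _) (by
      rw [hp.ncard_neighborSet_toSubgraph_internal_eq_two h0 hi, hc.ncard_neighborSet])
  have hcases : ∀ x ∈ p.support, x = u ∨ x = v ∨
      p.toSubgraph.neighborSet x = c.toSubgraph.neighborSet x := by
    intro x hx
    obtain ⟨i, rfl, hi⟩ := p.mem_support_iff_exists_getVert.1 hx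
    by_cases h0 : i = 0
    · left; simp [h0]
    · rcases hi.eq_or_lt with h | h
      · right; left; simp [h]
      · exact Or.inr (Or.inr (hint i h0 h))
  have hws : c.toSubgraph.neighborSet w ⊆ {u, v} := by
    intro x hx
    have hxp : x ∈ p.support := (hpw x).2 hx.adj_sub
    rcases hcases x hxp with h | h | h
    · exact Or.inl h
    · exact Or.inr h
    · have : w ∈ p.toSubgraph.neighborSet x := by
        rw [h]; exact Subgraph.Adj.symm hx
      exact absurd (hpmem _ _ this) hwp
  have hwn := hc.ncard_neighborSet w
  -- If `p` had one vertex, `w` would have only one neighbour in the cycle.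
  have huv : u ≠ v := by
    rintro rfl
    have := Set.ncard_le_ncard hws
    simp only [Set.pair_eq_singleton, Set.ncard_singleton] at this
    omega
  have hwe : c.toSubgraph.neighborSet w = {u, v} :=
    Set.eq_of_subset_of_ncard_le hws (by rw [Set.ncard_pair huv, hwn])
  have hnil : ¬ p.Nil := fun h => huv h.eq
  have hend : ∀ x y, x ∈ ({u, v} : Set V) → p.toSubgraph.neighborSet x = {y} →
      c.toSubgraph.neighborSet x = {w, y} := by
    intro x y hx hy
    have hyp : y ∈ p.toSubgraph.neighborSet x := by rw [hy]; rfl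
    have hne : w ≠ y := fun e => hwp (e ▸ hpmem _ _ hyp)
    refine (Set.eq_of_subset_of_ncard_le ?_ ?_).symm
    · rintro b (rfl | rfl)
      · rw [← hwe] at hx
        exact Subgraph.Adj.symm hx
      · exact hsub _ hyp
    · rw [Set.ncard_pair hne, hc.ncard_neighborSet]
  -- The path together with `w` already closes up, so the cycle cannot leave this set to reach `z`.
  have hclosed : ∀ x ∈ {x | x = w ∨ x ∈ p.support}, ∀ y, c.toSubgraph.Adj x y →
      y ∈ {x | x = w ∨ x ∈ p.support} := by
    rintro x hx y hy
    change y ∈ c.toSubgraph.neighborSet x at hy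
    have hendcase : ∀ s, x ∈ ({u, v} : Set V) → p.toSubgraph.neighborSet x = {s} →
        y = w ∨ y ∈ p.support := by
      intro s hx hs
      rw [hend x s hx hs] at hy
      rcases hy with rfl | rfl
      · exact Or.inl rfl
      · exact Or.inr (hpmem x _ (by rw [hs]; rfl))
    rcases hx with rfl | hx
    · rw [hwe] at hy
      rcases hy with rfl | rfl
      · exact Or.inr p.start_mem_support
      · exact Or.inr p.end_mem_support
    · rcases hcases x hx with rfl | rfl | h
      · exact hendcase _ (by simp) (hp.neighborSet_toSubgraph_startpoint hnil)
      · exact hendcase _ (by simp) (hp.neighborSet_toSubgraph_endpoint hnil)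
      · rw [← h] at hy
        exact Or.inr (hpmem x y hy)
  let c' := c.rotate w (hc.mem_support w)
  have hzc : z ∈ c'.support := ((Walk.isHamiltonianCycle_rotate _).2 hc).mem_support z
  obtain ⟨e, he, he1, he2⟩ := (c'.takeUntil z hzc).exists_boundary_dart
    {x | x = w ∨ x ∈ p.support} (Or.inl rfl) (by
      rintro (h | h)
      · exact hz h
      · exact hzw ((hpw z).1 h))
  refine he2 (hclosed _ he1 _ ?_)
  rw [← Walk.toSubgraph_rotate c (hc.mem_support w), Walk.adj_toSubgraph_iff_mem_edges]
  exact List.mem_map_of_mem (f := Dart.edge) (c'.darts_takeUntil_subset_darts hzc he)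

variable {d : ℕ}

theorem IsCompletePlusVertex.not_isTraceable (h : G.IsCompletePlusVertex 0)
    (hV : 2 ≤ Fintype.card V) : ¬ G.IsTraceable := by
  obtain ⟨w, hw, -⟩ := h
  simp only [Nat.cast_zero, Set.encard_eq_zero] at hw
  exact not_isTraceable_of_isolated (fun x hx => by
    have : x ∈ G.neighborSet w := hx
    simp [hw] at this) hV

theorem IsCompletePlusVertex.not_isHamiltonian (h : G.IsCompletePlusVertex 1)
    (hV : Fintype.card V ≠ 1) : ¬ G.IsHamiltonian := by
  obtain ⟨w, hw, -⟩ := h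
  exact not_isHamiltonian_of_encard_neighborSet_le_one (w := w) (by simp [hw]) hV

omit [DecidableEq V] in
theorem exists_ne_not_adj {w : V} (hw : (G.neighborSet w).encard = d)
    (hV : d + 2 ≤ Fintype.card V) : ∃ z, z ≠ w ∧ ¬ G.Adj w z := by
  by_contra! hcon
  have h1 : (Set.univ : Set V) ⊆ insert w (G.neighborSet w) := fun z _ => by
    by_cases hz : z = w
    · exact Or.inl hz
    · exact Or.inr (hcon z hz)
  have h2 := (Set.encard_le_encard h1).trans (Set.encard_insert_le _ _)
  rw [hw, Set.encard_univ, ENat.card_eq_coe_fintype_card] at h2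
  have h3 : Fintype.card V ≤ d + 1 := by exact_mod_cast h2
  omega

/-- The two neighbours `a`, `b` of `w` are adjacent. A Hamiltonian path from `b` to `a`, closed by
this edge, would be a Hamiltonian cycle containing a path through exactly the neighbours of `w`. -/
theorem IsCompletePlusVertex.not_isHamiltonianConnected (h : G.IsCompletePlusVertex 2)
    (hV : 4 ≤ Fintype.card V) : ¬ G.IsHamiltonianConnected := by
  intro hG
  obtain ⟨w, hw, hadj⟩ := h
  obtain ⟨z, hz, hzw⟩ := exists_ne_not_adj hw (by omega)
  obtain ⟨a, b, hab, hN⟩ := Set.encard_eq_two.1 hw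
  have hwa : G.Adj w a := by
    change a ∈ G.neighborSet w; simp [hN]
  have hwb : G.Adj w b := by
    change b ∈ G.neighborSet w; simp [hN]
  have e : G.Adj a b := hadj a b hwa.ne' hwb.ne' hab
  obtain ⟨q, hq⟩ := hG b a hab.symm
  have hp : (Walk.cons e Walk.nil).IsPath := by simp [hab]
  have hlen := hq.length_eq
  have hc : ((Walk.cons e Walk.nil).append q).IsHamiltonianCycle := by
    rw [Walk.isHamiltonianCycle_iff_isCycle_and_length_eq]
    refine ⟨hp.isCycle_append hq.isPath ?_ (Or.inr (by omega)), ?_⟩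
    · have hn := hq.isPath.support_nodup
      rw [← Walk.cons_tail_support q, List.nodup_cons] at hn
      simpa using hn.1
    · rw [Walk.length_append, Walk.length_cons, Walk.length_nil]
      omega
  refine hzw (hc.adj_of_path_through_neighborSet hp ?_ (fun x => ?_) hz)
  · rw [Walk.toSubgraph_append]
    exact le_sup_left
  · rw [← mem_neighborSet, hN]
    simp

/-- The neighbours of `w` form a clique of `k + 1` vertices, so a path of length `k` runs through
exactly these. -/
theorem IsCompletePlusVertex.not_isPathHamiltonian {k : ℕ} (h : G.IsCompletePlusVertex (k + 1))
    (hV : k + 3 ≤ Fintype.card V) : ¬ G.IsPathHamiltonian k := by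
  classical
  intro hG
  obtain ⟨w, hw, hadj⟩ := h
  obtain ⟨z, hz, hzw⟩ := exists_ne_not_adj hw (by omega)
  have hlen : (G.neighborFinset w).toList.length = k + 1 := by
    rw [length_toList]
    rw [← coe_neighborFinset, Set.encard_coe_eq_coe_finsetCard] at hw
    exact_mod_cast hw
  have hmem : ∀ x, x ∈ (G.neighborFinset w).toList ↔ G.Adj w x := by simp
  have hnd := (G.neighborFinset w).nodup_toList
  generalize (G.neighborFinset w).toList = L at *
  have hch : L.IsChain G.Adj := (hnd.imp_of_mem fun {x y} hx hy hxy =>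
    hadj x y ((hmem x).1 hx).ne' ((hmem y).1 hy).ne' hxy).isChain
  have hne : L ≠ [] := by
    rintro rfl; simp at hlen
  have hp : (Walk.ofSupport L hne hch).IsPath := Walk.IsPath.mk' (by simpa using hnd)
  obtain ⟨a, c, hc, hle⟩ := hG _ _ _ hp (by rw [Walk.length_ofSupport]; omega)
  exact hzw (hc.adj_of_path_through_neighborSet hp hle (fun x => by simp [hmem]) hz)

/-- Deleting `k` of the `k + 1` neighbours of `w` leaves it with degree at most 1 among at least
three vertices. -/
theorem IsCompletePlusVertex.not_isKHamiltonian {k : ℕ} (h : G.IsCompletePlusVertex (k + 1))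
    (hV : k + 3 ≤ Fintype.card V) : ¬ G.IsKHamiltonian k := by
  classical
  intro hG
  obtain ⟨w, hw, -⟩ := h
  rw [← coe_neighborFinset, Set.encard_coe_eq_coe_finsetCard] at hw
  have hw' : #(G.neighborFinset w) = k + 1 := by exact_mod_cast hw
  obtain ⟨s, hs, hsk⟩ := exists_subset_card_eq (show k ≤ #(G.neighborFinset w) by omega)
  have hws : w ∈ (↑(sᶜ) : Set V) := by
    simp only [coe_compl, Set.mem_compl_iff, mem_coe]
    intro hmem
    simpa using hs hmem
  refine not_isHamiltonian_of_encard_neighborSet_le_one (w := ⟨w, hws⟩) ?_ ?_ (hG s hsk.le)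
  · rw [← Subtype.val_injective.encard_image]
    have hsub : Subtype.val '' ((G.induce (↑(sᶜ) : Set V)).neighborSet ⟨w, hws⟩) ⊆
        ↑(G.neighborFinset w \ s) := by
      rintro _ ⟨x, hx, rfl⟩
      have hx2 := x.2
      simp only [coe_compl, Set.mem_compl_iff, mem_coe] at hx2
      simpa [hx2] using hx
    refine (Set.encard_le_encard hsub).trans ?_
    rw [Set.encard_coe_eq_coe_finsetCard, card_sdiff_of_subset hs, hw', hsk]
    simp
  · have h2 : Fintype.card (↑(sᶜ) : Set V) = Fintype.card V - #s := by
      rw [← card_compl, ← Fintype.card_coe]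
      exact Fintype.card_congr (Equiv.refl _)
    omega

end Obstructions

/-! ### Combining the edge threshold with the clique bound -/

variable {V : Type*} [Fintype V] [DecidableEq V] {G : SimpleGraph V} {t : ℕ}

theorem numCliques_le_of_degreeSumOn {P : Prop} (j : ℕ) (ht : 2 ≤ t)
    (hP : Gᶜ.degreeSumOn univ + 4 + 2 * j ≤ 2 * Fintype.card V → P) (hn : ¬ P) :
    G.numCliques t ≤ (colexGraphNat ((Fintype.card V - 1).choose 2 + j)).numCliques t := by
  refine numCliques_le_colexGraphNat ht G (not_lt.1 fun hlt => hn (hP ?_))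
  exact G.degreeSumOn_compl_of_lt_ncard_edgeSet hlt

theorem numCliques_le_colexGraph_of_degreeSumOn {P : Prop} (j : ℕ) (ht : 2 ≤ t)
    (hP : Gᶜ.degreeSumOn univ + 4 + 2 * j ≤ 2 * Fintype.card V → P) (hn : ¬ P) :
    G.numCliques t ≤ (colexGraph ((Fintype.card V - 1).choose 2 + j)).numCliques t := by
  rw [numCliques_colexGraph _ ht]
  exact numCliques_le_of_degreeSumOn j ht hP hn

theorem IsCompletePlusVertex.numCliques_eq (h : G.IsCompletePlusVertex 0) (ht : 2 ≤ t) :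
    G.numCliques t = (⊤ : SimpleGraph (Fin (Fintype.card V - 1))).numCliques t := by
  obtain ⟨w, hw, hadj⟩ := h
  simp only [Nat.cast_zero, Set.encard_eq_zero] at hw
  have hcard : Fintype.card {x : V // x ≠ w} = Fintype.card V - 1 := by
    rw [Fintype.card_subtype_compl, Fintype.card_subtype_eq]
  let e : Fin (Fintype.card V - 1) ≃ {x : V // x ≠ w} := (Fintype.equivFinOfCardEq hcard).symm
  refine (numCliques_eq_of_embedding
    ⟨e.toEmbedding.trans (Function.Embedding.subtype _), ?_⟩ t fun s hs x hx => ?_).symm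
  · intro a b
    change G.Adj (e a) (e b) ↔ a ≠ b
    refine ⟨fun h e => h.ne (by rw [e]), fun h => ?_⟩
    exact hadj _ _ (e a).2 (e b).2 fun h' => h (e.injective (Subtype.ext h'))
  · obtain ⟨y, -, hy⟩ := exists_adj_of_mem_clique ht hs hx
    have hxw : x ≠ w := by
      rintro rfl
      have : y ∈ G.neighborSet x := hy
      simp [hw] at this
    exact ⟨e.symm ⟨x, hxw⟩, by
      change ((e (e.symm ⟨x, hxw⟩) : {x : V // x ≠ w}) : V) = x
      rw [Equiv.apply_symm_apply]⟩

end SimpleGraph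

theorem mainTheorem12 {V : Type*} [Fintype V] [DecidableEq V] (G : SimpleGraph V)
    (n : ℕ) (hn : 1 ≤ n) (hV : Fintype.card V = n) (t : ℕ) (ht : 2 ≤ t) :
    -- traceability
    ((¬ G.IsTraceable → G.numCliques t ≤ (⊤ : SimpleGraph (Fin (n - 1))).numCliques t) ∧
      (G.IsCompletePlusVertex 0 →
        (2 ≤ n → ¬ G.IsTraceable) ∧
        G.numCliques t = (⊤ : SimpleGraph (Fin (n - 1))).numCliques t)) ∧
    -- Hamiltonicity
    ((¬ G.IsHamiltonian →
        G.numCliques t ≤ (SimpleGraph.colexGraph ((n - 1).choose 2 + 1)).numCliques t) ∧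
      (Nonempty (G ≃g SimpleGraph.colexGraph ((n - 1).choose 2 + 1)) →
        ¬ G.IsHamiltonian ∧
        G.numCliques t = (SimpleGraph.colexGraph ((n - 1).choose 2 + 1)).numCliques t) ∧
      (2 ≤ n →
        (SimpleGraph.colexGraphNat ((n - 1).choose 2 + 1)).support.encard = n ∧
        (SimpleGraph.colexGraph ((n - 1).choose 2 + 1)).IsCompletePlusVertex 1)) ∧
    -- Hamiltonian-connectedness
    (4 ≤ n →
      (¬ G.IsHamiltonianConnected →
        G.numCliques t ≤ (SimpleGraph.colexGraph ((n - 1).choose 2 + 2)).numCliques t) ∧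
      (Nonempty (G ≃g SimpleGraph.colexGraph ((n - 1).choose 2 + 2)) →
        ¬ G.IsHamiltonianConnected ∧
        G.numCliques t = (SimpleGraph.colexGraph ((n - 1).choose 2 + 2)).numCliques t) ∧
      (SimpleGraph.colexGraphNat ((n - 1).choose 2 + 2)).support.encard = n ∧
      (SimpleGraph.colexGraph ((n - 1).choose 2 + 2)).IsCompletePlusVertex 2) ∧
    -- `k`-path Hamiltonicity
    (∀ k : ℕ, k + 3 ≤ n →
      (¬ G.IsPathHamiltonian k →
        G.numCliques t ≤ (SimpleGraph.colexGraph ((n - 1).choose 2 + k + 1)).numCliques t) ∧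
      (Nonempty (G ≃g SimpleGraph.colexGraph ((n - 1).choose 2 + k + 1)) →
        ¬ G.IsPathHamiltonian k ∧
        G.numCliques t = (SimpleGraph.colexGraph ((n - 1).choose 2 + k + 1)).numCliques t)) ∧
    -- `k`-Hamiltonicity
    (∀ k : ℕ, k + 3 ≤ n →
      (¬ G.IsKHamiltonian k →
        G.numCliques t ≤ (SimpleGraph.colexGraph ((n - 1).choose 2 + k + 1)).numCliques t) ∧
      (Nonempty (G ≃g SimpleGraph.colexGraph ((n - 1).choose 2 + k + 1)) →
        ¬ G.IsKHamiltonian k ∧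
        G.numCliques t = (SimpleGraph.colexGraph ((n - 1).choose 2 + k + 1)).numCliques t)) ∧
    -- the colex graph of the last two parts
    (∀ k : ℕ, k + 3 ≤ n →
      (SimpleGraph.colexGraphNat ((n - 1).choose 2 + k + 1)).support.encard = n ∧
      (SimpleGraph.colexGraph ((n - 1).choose 2 + k + 1)).IsCompletePlusVertex (k + 1)) := by
  subst hV
  have hne : Nonempty V := Fintype.card_pos_iff.1 hn
  have hcolex : ∀ d, 1 ≤ d → d + 1 ≤ Fintype.card V →
      (SimpleGraph.colexGraph ((Fintype.card V - 1).choose 2 + d)).IsCompletePlusVertex d :=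
    fun d h1 h2 => SimpleGraph.isCompletePlusVertex_colexGraph h1 h2
  have hsupp : ∀ d, 1 ≤ d → d + 1 ≤ Fintype.card V →
      (SimpleGraph.colexGraphNat ((Fintype.card V - 1).choose 2 + d)).support.encard
        = Fintype.card V := fun d h1 h2 => by
    rw [SimpleGraph.support_colexGraphNat h1 h2, Set.encard_coe_eq_coe_finsetCard,
      Finset.card_range]
  refine ⟨⟨?_, ?_⟩, ⟨?_, ?_, ?_⟩, fun h4 => ⟨?_, ?_, hsupp 2 (by omega) (by omega),
    hcolex 2 (by omega) (by omega)⟩, fun k hk => ⟨?_, ?_⟩, fun k hk => ⟨?_, ?_⟩, fun k hk =>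
    ⟨hsupp (k + 1) (by omega) (by omega), hcolex (k + 1) (by omega) (by omega)⟩⟩
  · rw [SimpleGraph.numCliques_colexGraphNat_choose_two _ ht]
    exact SimpleGraph.numCliques_le_of_degreeSumOn 0 ht G.isTraceable_of_degreeSumOn_le
  · exact fun h => ⟨h.not_isTraceable, h.numCliques_eq ht⟩
  · exact SimpleGraph.numCliques_le_colexGraph_of_degreeSumOn 1 ht
      fun h => G.isHamiltonian_of_degreeSumOn_le (by omega)
  · rintro ⟨f⟩
    -- At n = 1 the colex graph is a single edge on two vertices, so the isomorphism excludes the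
    -- one-vertex graph, which is Hamiltonian by convention.
    have h2 : Fintype.card V ≠ 1 := by
      intro h1
      have hadj : (SimpleGraph.colexGraphNat ((Fintype.card V - 1).choose 2 + 1)).Adj 0 1 := by
        rw [SimpleGraph.colexGraphNat_adj_iff_of_lt one_pos]
        simp [h1]
      have hsub := Fintype.card_le_one_iff_subsingleton.1 h1.le
      exact zero_ne_one (congr_arg Subtype.val (f.symm.injective
        (Subsingleton.elim (f.symm ⟨0, 1, hadj⟩) (f.symm ⟨1, 0, hadj.symm⟩))))
    exact ⟨((hcolex 1 le_rfl (by omega)).of_iso f).not_isHamiltonian h2,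
      SimpleGraph.numCliques_congr f t⟩
  · exact fun h2 => ⟨hsupp 1 le_rfl h2, hcolex 1 le_rfl h2⟩
  · exact SimpleGraph.numCliques_le_colexGraph_of_degreeSumOn 2 ht
      fun h => G.isHamiltonianConnected_of_degreeSumOn_le (by omega)
  · rintro ⟨f⟩
    exact ⟨((hcolex 2 (by omega) (by omega)).of_iso f).not_isHamiltonianConnected h4,
      SimpleGraph.numCliques_congr f t⟩
  · exact SimpleGraph.numCliques_le_colexGraph_of_degreeSumOn (k + 1) ht
      fun h => G.isPathHamiltonian_of_degreeSumOn_le k (by omega)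
  · rintro ⟨f⟩
    exact ⟨((hcolex (k + 1) (by omega) (by omega)).of_iso f).not_isPathHamiltonian hk,
      SimpleGraph.numCliques_congr f t⟩
  · exact SimpleGraph.numCliques_le_colexGraph_of_degreeSumOn (k + 1) ht
      fun h => G.isKHamiltonian_of_degreeSumOn_le k (by omega)
  · rintro ⟨f⟩
    exact ⟨((hcolex (k + 1) (by omega) (by omega)).of_iso f).not_isKHamiltonian hk,
      SimpleGraph.numCliques_congr f t⟩
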